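/- Let $s=s^{\{S\}}\ge 1$ and let $\Omega^{\{0\}},\dots,\Omega^{\{n_\Omega-1\}},\Gamma\in\mathbb R^{s\times s}$ and $c^{\{S\}}\in\mathbb R^{s}$ be the coefficients of an IMEX-MRI-SR method (the $\Omega^{\{k\}}$ strictly lower triangular, $\Gamma$ lower triangular with zero first row), and let $(A^{\{F\}},b^{\{F\}},c^{\{F\}})$ be a Runge--Kutta method with $s^{\{F\}}$ stages and $c^{\{F\}}=A^{\{F\}}\mathbb 1$ (the fast method). Put $\omega_{i,l}(\tau)=\sum_{k=0}^{n_\Omega-1}\omega^{\{k\}}_{i,l}\tau^k$ and $\overline\Omega=\sum_{k=0}^{n_\Omega-1}\frac1{k+1}\Omega^{\{k\}}$. Applied to $y'=f^{\{F\}}(t,y)+f^{\{I\}}(t,y)+f^{\{E\}}(t,y)$, one step of size $H$ from $(t_n,y_n)$ is $$V_{i,j}=y_n+c^{\{S\}}_iH\sum_{k}a^{\{F\}}_{j,k}f^{\{F\}}_{i,k}+H\sum_k a^{\{F\}}_{j,k}\sum_{l<i}\omega_{i,l}(c^{\{F\}}_k)\,(f^{\{E\}}_l+f^{\{I\}}_l),$$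 $$Y_i=y_n+c^{\{S\}}_iH\sum_{k}b^{\{F\}}_{k}f^{\{F\}}_{i,k}+H\sum_k b^{\{F\}}_{k}\sum_{l<i}\omega_{i,l}(c^{\{F\}}_k)\,(f^{\{E\}}_l+f^{\{I\}}_l)+H\sum_{l\le i}\gamma_{i,l}f^{\{I\}}_l,$$ for $1\le i\le s$, $1\le j\le s^{\{F\}}$, with $y_{n+1}=Y_s$, where $f^{\{F\}}_{i,k}=f^{\{F\}}(t_n+c^{\{S\}}_ic^{\{F\}}_kH,V_{i,k})$ and $f^{\{\sigma\}}_l=f^{\{\sigma\}}(t_n+c^{\{S\}}_lH,Y_l)$ for $\sigma\in\{E,I\}$; that is, each fast initial value problem of the method is solved by one step of the fast method. A one-step method is called accurate of order $p$ if for all smooth right-hand sides on $\mathbb R\times\mathbb R^d$ (any $d$), and for every initial value, for all sufficiently small $H>0$ its stage equations have a solution near the initial value and all such solutions give a local error $O(H^{p+1})$ as $H\to0^+$. Assume: 1. (internal consistency) the GARK abscissae agree, i.e. $\mathbf c^{\{F,F\}}=\mathbf c^{\{F,E\}}=\mathbf c^{\{F,I\}}$ and $\mathbf c^{\{S,F\}}=\mathbf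 c^{\{S,E\}}=\mathbf c^{\{S,I\}}$, where $\mathbf c^{\{\sigma,\nu\}}=\mathbf A^{\{\sigma,\nu\}}\mathbb 1$ and, with $C^{\{S\}}=\operatorname{diag}(c^{\{S\}})$, $\mathbf A^{\{F,F\}}=C^{\{S\}}\otimes A^{\{F\}}$, $\mathbf A^{\{F,E\}}=\mathbf A^{\{F,I\}}=\sum_{k=0}^{n_\Omega-1}\Omega^{\{k\}}\otimes A^{\{F\}}(c^{\{F\}})^{\times k}$, $\mathbf A^{\{S,F\}}=C^{\{S\}}\otimes b^{\{F\},T}$, $\mathbf A^{\{S,E\}}=\overline\Omega$, $\mathbf A^{\{S,I\}}=\overline\Omega+\Gamma$ (here $v^{\times k}$ is the componentwise $k$-th power); 2. the slow base method, i.e. the additive Runge--Kutta method for $y'=f^{\{E\}}+f^{\{I\}}$ with explicit table $(\overline\Omega,\,e_s^T\overline\Omega,\,\overline\Omega\mathbb 1)$ and implicit table $(\overline\Omega+\Gamma,\,e_s^T(\overline\Omega+\Gamma),\,(\overline\Omega+\Gamma)\mathbb 1)$, is third-order accurate; 3. the fast Runge--Kutta method is accurate of order $\max(3,n_\Omega+1)$.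 If $$e_{s}^T\left(\sum_{k=0}^{n_\Omega-1}\frac{1}{(k+1)(k+2)}\,\Omega^{\{k\}}\right)c^{\{S\}}=\frac16,$$ where $e_s$ is the last unit vector, then the IMEX-MRI-SR method is third-order accurate. -/

import Mathlib

/-! ### Initial value problems and the order of a one-step method -/

/-- The right-hand side `f (t, y)` is smooth in `(t, y)` jointly. -/
def SmoothRHS {d : ℕ} (f : ℝ → (Fin d → ℝ) → (Fin d → ℝ)) : Prop :=
  ContDiff ℝ ((⊤ : ℕ∞) : WithTop ℕ∞) (fun p : ℝ × (Fin d → ℝ) => f p.1 p.2)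

/-- `y` solves `y' = f (t, y)`, `y t₀ = y₀` on `[t₀, t₀ + T]`. -/
def IsSolutionIVP {d : ℕ} (f : ℝ → (Fin d → ℝ) → (Fin d → ℝ)) (t₀ T : ℝ) (y₀ : Fin d → ℝ)
    (y : ℝ → (Fin d → ℝ)) : Prop :=
  y t₀ = y₀ ∧
    ∀ t ∈ Set.Icc t₀ (t₀ + T), HasDerivWithinAt y (f t (y t)) (Set.Icc t₀ (t₀ + T)) t

/-- Local error of order `p + 1` for a (possibly implicit) one-step method.  For step size `H`,
`stageEq H Z` says that `Z` is a solution of the stage equations and `update H Z` is the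
approximation at time `t₀ + H` computed from the stages `Z`.  As usual for implicit methods, the
stages are those close to the initial value: for all small `H > 0` the stage equations are
solvable near `y₀`, and every such solution yields an error of at most `C * H ^ (p + 1)`. -/
def LocalErrorOrder {d : ℕ} {ι : Type} (p : ℕ) (stageEq : ℝ → (ι → (Fin d → ℝ)) → Prop)
    (update : ℝ → (ι → (Fin d → ℝ)) → (Fin d → ℝ)) (t₀ : ℝ) (y₀ : Fin d → ℝ)
    (y : ℝ → (Fin d → ℝ)) : Prop :=
  ∃ r > 0, ∃ H₀ > 0, ∃ C : ℝ, ∀ H : ℝ, 0 < H → H < H₀ →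
    (∃ Z : ι → (Fin d → ℝ), (∀ i, ‖Z i - y₀‖ ≤ r) ∧ stageEq H Z) ∧
    ∀ Z : ι → (Fin d → ℝ), (∀ i, ‖Z i - y₀‖ ≤ r) → stageEq H Z →
      ‖update H Z - y (t₀ + H)‖ ≤ C * H ^ (p + 1)

/-! ### Runge--Kutta methods -/

/-- A Runge--Kutta method given by its Butcher table `(A, b, c)`, with the usual convention that
the abscissae are the row sums of `A`. -/
structure RKMethod (s : ℕ) where
  A : Matrix (Fin s) (Fin s) ℝ
  b : Fin s → ℝ
  c : Fin s → ℝ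
  row_sum : ∀ i, ∑ j, A i j = c i

namespace RKMethod

variable {s d : ℕ} (M : RKMethod s)

/-- Stage equations of one step of size `H` from `(t₀, y₀)`. -/
def StageEq (f : ℝ → (Fin d → ℝ) → (Fin d → ℝ)) (t₀ : ℝ) (y₀ : Fin d → ℝ) (H : ℝ)
    (Y : Fin s → (Fin d → ℝ)) : Prop :=
  ∀ i, Y i = y₀ + H • ∑ j, M.A i j • f (t₀ + M.c j * H) (Y j)

/-- The result of one step. -/
def update (f : ℝ → (Fin d → ℝ) → (Fin d → ℝ)) (t₀ : ℝ) (y₀ : Fin d → ℝ) (H : ℝ)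
    (Y : Fin s → (Fin d → ℝ)) : Fin d → ℝ :=
  y₀ + H • ∑ j, M.b j • f (t₀ + M.c j * H) (Y j)

/-- The method is accurate of order (at least) `p`. -/
def HasOrder (p : ℕ) : Prop :=
  ∀ (d : ℕ) (f : ℝ → (Fin d → ℝ) → (Fin d → ℝ)), SmoothRHS f →
    ∀ (t₀ T : ℝ) (y₀ : Fin d → ℝ) (y : ℝ → (Fin d → ℝ)), 0 < T → IsSolutionIVP f t₀ T y₀ y →
      LocalErrorOrder p (M.StageEq f t₀ y₀) (M.update f t₀ y₀) t₀ y₀ y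

end RKMethod

/-! ### Additive Runge--Kutta (ARK) methods for `y' = fE + fI` -/

/-- An additive Runge--Kutta method: two Butcher tables with common stages. -/
structure ARKMethod (s : ℕ) where
  AE : Matrix (Fin s) (Fin s) ℝ
  bE : Fin s → ℝ
  cE : Fin s → ℝ
  AI : Matrix (Fin s) (Fin s) ℝ
  bI : Fin s → ℝ
  cI : Fin s → ℝ

namespace ARKMethod

variable {s d : ℕ} (M : ARKMethod s)

/-- Stage equations of one step of size `H` from `(t₀, y₀)`. -/
def StageEq (fE fI : ℝ → (Fin d → ℝ) → (Fin d → ℝ)) (t₀ : ℝ) (y₀ : Fin d → ℝ) (H : ℝ)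
    (Y : Fin s → (Fin d → ℝ)) : Prop :=
  ∀ i, Y i = y₀ + H • ∑ j, M.AE i j • fE (t₀ + M.cE j * H) (Y j)
    + H • ∑ j, M.AI i j • fI (t₀ + M.cI j * H) (Y j)

/-- The result of one step. -/
def update (fE fI : ℝ → (Fin d → ℝ) → (Fin d → ℝ)) (t₀ : ℝ) (y₀ : Fin d → ℝ) (H : ℝ)
    (Y : Fin s → (Fin d → ℝ)) : Fin d → ℝ :=
  y₀ + H • ∑ j, M.bE j • fE (t₀ + M.cE j * H) (Y j)
    + H • ∑ j, M.bI j • fI (t₀ + M.cI j * H) (Y j)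

/-- The method is accurate of order (at least) `p`. -/
def HasOrder (p : ℕ) : Prop :=
  ∀ (d : ℕ) (fE fI : ℝ → (Fin d → ℝ) → (Fin d → ℝ)), SmoothRHS fE → SmoothRHS fI →
    ∀ (t₀ T : ℝ) (y₀ : Fin d → ℝ) (y : ℝ → (Fin d → ℝ)), 0 < T →
      IsSolutionIVP (fun t x => fE t x + fI t x) t₀ T y₀ y →
      LocalErrorOrder p (M.StageEq fE fI t₀ y₀) (M.update fE fI t₀ y₀) t₀ y₀ y

end ARKMethod

/-! ### IMEX-MRI-SR methods for `y' = fF + fI + fE` -/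

/-- Coefficients of an IMEX-MRI-SR method with `n + 1` slow stages and `nΩ` coupling matrices. -/
structure IMEXMRISR (n nΩ : ℕ) where
  Ω : Fin nΩ → Matrix (Fin (n + 1)) (Fin (n + 1)) ℝ
  Γ : Matrix (Fin (n + 1)) (Fin (n + 1)) ℝ
  c : Fin (n + 1) → ℝ
  Ω_strictLower : ∀ k i j, i ≤ j → Ω k i j = 0
  Γ_lower : ∀ i j, i < j → Γ i j = 0
  Γ_first_row : ∀ j, Γ 0 j = 0

namespace IMEXMRISR

variable {n nΩ sF d : ℕ} (M : IMEXMRISR n nΩ)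

/-- `ω_{i,j}(τ) = ∑ₖ Ωₖ(i,j) τᵏ`. -/
def omega (i j : Fin (n + 1)) (τ : ℝ) : ℝ := ∑ k : Fin nΩ, M.Ω k i j * τ ^ (k : ℕ)

/-- `Ω̄ = ∑ₖ Ωₖ / (k + 1)`, the matrix of the integrals of `ω_{i,j}` over `[0, 1]`. -/
noncomputable def Ωbar : Matrix (Fin (n + 1)) (Fin (n + 1)) ℝ :=
  ∑ k : Fin nΩ, (1 / ((k : ℝ) + 1)) • M.Ω k

/-- The slow base method: the stiffly accurate ARK method to which the scheme reduces for
`fF = 0`. -/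
noncomputable def slowBase : ARKMethod (n + 1) where
  AE := M.Ωbar
  bE := M.Ωbar (Fin.last n)
  cE := M.Ωbar.mulVec 1
  AI := M.Ωbar + M.Γ
  bI := (M.Ωbar + M.Γ) (Fin.last n)
  cI := (M.Ωbar + M.Γ).mulVec 1

/-- One step of size `H` from `(t₀, y₀)`, where in slow stage `i` the fast initial value problem
`v' (θ) = fF (t₀ + θ, v (θ)) + (1 / cᵢ) ∑_{l < i} ω_{i,l} (θ / (cᵢ H)) (fE_l + fI_l)`, `v (0) = y₀`,
on `[0, cᵢ H]` is solved by one step (of size `cᵢ H`) of the Runge--Kutta method `R`.  The unknowns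
are the fast stages `V_{i,j}` (`Z (Sum.inl (i, j))`) and the slow stages `Y_i` (`Z (Sum.inr i)`).
The factors `cᵢ` and `1 / cᵢ` in front of the slow tendencies are cancelled. -/
def StageEq (R : RKMethod sF) (fF fE fI : ℝ → (Fin d → ℝ) → (Fin d → ℝ)) (t₀ : ℝ)
    (y₀ : Fin d → ℝ) (H : ℝ) (Z : (Fin (n + 1) × Fin sF) ⊕ Fin (n + 1) → (Fin d → ℝ)) : Prop :=
  let V : Fin (n + 1) → Fin sF → (Fin d → ℝ) := fun i j => Z (Sum.inl (i, j))
  let Y : Fin (n + 1) → (Fin d → ℝ) := fun i => Z (Sum.inr i)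
  let gF : Fin (n + 1) → Fin sF → (Fin d → ℝ) :=
    fun i k => fF (t₀ + M.c i * R.c k * H) (V i k)
  let gE : Fin (n + 1) → (Fin d → ℝ) := fun l => fE (t₀ + M.c l * H) (Y l)
  let gI : Fin (n + 1) → (Fin d → ℝ) := fun l => fI (t₀ + M.c l * H) (Y l)
  (∀ i j, V i j = y₀ + (M.c i * H) • ∑ k, R.A j k • gF i k
      + H • ∑ k, R.A j k • ∑ l ∈ Finset.Iio i, M.omega i l (R.c k) • (gE l + gI l)) ∧
  (∀ i, Y i = y₀ + (M.c i * H) • ∑ k, R.b k • gF i k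
      + H • ∑ k, R.b k • ∑ l ∈ Finset.Iio i, M.omega i l (R.c k) • (gE l + gI l)
      + H • ∑ l ∈ Finset.Iic i, M.Γ i l • gI l)

/-- The result of one step is the last slow stage. -/
def update (_ : ℝ) (Z : (Fin (n + 1) × Fin sF) ⊕ Fin (n + 1) → (Fin d → ℝ)) : Fin d → ℝ :=
  Z (Sum.inr (Fin.last n))

/-- The IMEX-MRI-SR method with fast method `R` is accurate of order (at least) `p`. -/
def HasOrder (R : RKMethod sF) (p : ℕ) : Prop :=
  ∀ (d : ℕ) (fF fE fI : ℝ → (Fin d → ℝ) → (Fin d → ℝ)),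
    SmoothRHS fF → SmoothRHS fE → SmoothRHS fI →
    ∀ (t₀ T : ℝ) (y₀ : Fin d → ℝ) (y : ℝ → (Fin d → ℝ)), 0 < T →
      IsSolutionIVP (fun t x => fF t x + fI t x + fE t x) t₀ T y₀ y →
      LocalErrorOrder p (M.StageEq R fF fE fI t₀ y₀) update t₀ y₀ y

/-! The tables of the scheme as a generalized additive Runge--Kutta (GARK) method. -/

/-- `A^{F,F} = diag(c) ⊗ A`. -/
def AFF (R : RKMethod sF) : Matrix (Fin (n + 1) × Fin sF) (Fin (n + 1) × Fin sF) ℝ :=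
  Matrix.kronecker (Matrix.diagonal M.c) R.A

/-- `A^{F,E} = ∑ₖ Ωₖ ⊗ (A c^{×k})`. -/
def AFE (R : RKMethod sF) : Matrix (Fin (n + 1) × Fin sF) (Fin (n + 1)) ℝ :=
  Matrix.of fun ij l => ∑ k : Fin nΩ, M.Ω k ij.1 l * R.A.mulVec (R.c ^ (k : ℕ)) ij.2

/-- `A^{F,I} = A^{F,E}`. -/
def AFI (R : RKMethod sF) : Matrix (Fin (n + 1) × Fin sF) (Fin (n + 1)) ℝ := M.AFE R

/-- `A^{S,F} = diag(c) ⊗ bᵀ`. -/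
def ASF (R : RKMethod sF) : Matrix (Fin (n + 1)) (Fin (n + 1) × Fin sF) ℝ :=
  Matrix.of fun i lj => Matrix.diagonal M.c i lj.1 * R.b lj.2

/-- `A^{S,E} = Ω̄`. -/
noncomputable def ASE : Matrix (Fin (n + 1)) (Fin (n + 1)) ℝ := M.Ωbar

/-- `A^{S,I} = Ω̄ + Γ`. -/
noncomputable def ASI : Matrix (Fin (n + 1)) (Fin (n + 1)) ℝ := M.Ωbar + M.Γ

/-- GARK internal consistency: `c^{F,F} = c^{F,E} = c^{F,I}` and `c^{S,F} = c^{S,E} = c^{S,I}`. -/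
def InternallyConsistent (R : RKMethod sF) : Prop :=
  (M.AFF R).mulVec 1 = (M.AFE R).mulVec 1 ∧ (M.AFE R).mulVec 1 = (M.AFI R).mulVec 1 ∧
    (M.ASF R).mulVec 1 = M.ASE.mulVec 1 ∧ M.ASE.mulVec 1 = M.ASI.mulVec 1

end IMEXMRISR

/-! The scheme is one partitioned Runge–Kutta method. Its stage set is the disjoint union of fast
and slow stages, its three tables are the GARK tables padded with zero columns, and its result is
the last slow stage rather than a separate weighted sum. Time is adjoined as a component of the
state. Internal consistency makes the three tables share their row sums `c`, so the Taylor expansion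
of a stage involves only the sum `g` of the three right-hand sides and the derivatives of each part
in direction `g`. Comparing with the exact solution (`sub_solution_isBigO`) leaves, at the result
stage `e`, the conditions `c e = 1`, `∑ a c = 1/2`, `∑ a c ^ 2 = 1/3` and, for each ordered pair of
tables, `∑ a (a' c) = 1/6`.

These conditions come from four sources (`order_conditions`). Pairs of slow tables are conditions on
the slow base method, and the fast-fast pair is one on the fast method. In a slow-fast pair the
inner sum collapses to `c ^ 2 / 2`, which leaves the quadrature condition `1/3`. In a fast-slow pair
the identity `bᵀ A c ^ k = 1 / ((k + 1) (k + 2))` of the fast method turns the sum into the coupling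
hypothesis.

The two order hypotheses are analytic, so algebraic conditions are first extracted from them by
means of the test problem `quadratureRHS`, whose local errors are explicit monomials in `H`.
Solvability of the stage equations follows from a contraction argument. -/

open Filter Topology Asymptotics

/-! ### Second-order Taylor expansions and their composition with curves -/

section Expansion

variable {E : Type*} [NormedAddCommGroup E] [NormedSpace ℝ E]

/-- If the derivative is `O(h ^ k)` to the right of `0`, the function is `O(h ^ (k + 1))`. -/
theorem isBigO_pow_succ_of_hasDerivWithinAt {T : ℝ} (hT : 0 < T) {w w' : ℝ → E}
    (hw : ∀ h ∈ Set.Icc 0 T, HasDerivWithinAt w (w' h) (Set.Icc 0 T) h) (h0 : w 0 = 0) {k : ℕ}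
    (hO : w' =O[𝓝[≥] 0] fun h : ℝ => h ^ k) : w =O[𝓝[≥] 0] fun h : ℝ => h ^ (k + 1) := by
  obtain ⟨C, hC⟩ := hO.bound
  rw [eventually_nhdsWithin_iff, Metric.eventually_nhds_iff] at hC
  obtain ⟨δ, hδ, hC⟩ := hC
  refine IsBigO.of_bound C ?_
  rw [eventually_nhdsWithin_iff, Metric.eventually_nhds_iff]
  refine ⟨min δ T, lt_min hδ hT, fun h hh hh0 => ?_⟩
  rw [Set.mem_Ici] at hh0
  rw [Real.dist_eq, sub_zero, abs_of_nonneg hh0, lt_min_iff] at hh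
  have hsub : Set.Icc 0 h ⊆ Set.Icc 0 T := Set.Icc_subset_Icc_right hh.2.le
  have hC0 : 0 ≤ C * h ^ k := by
    have := hC (y := h) (by rw [Real.dist_eq, sub_zero, abs_of_nonneg hh0]; exact hh.1) hh0
    rw [Real.norm_of_nonneg (pow_nonneg hh0 k)] at this
    exact (norm_nonneg _).trans this
  have hbd : ∀ x ∈ Set.Icc 0 h, ‖w' x‖ ≤ C * h ^ k := by
    intro x hx
    have hx' := hC (y := x)
      (by rw [Real.dist_eq, sub_zero, abs_of_nonneg hx.1]; exact hx.2.trans_lt hh.1) hx.1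
    rw [Real.norm_of_nonneg (pow_nonneg hx.1 k)] at hx'
    -- The constant of a big-O bound may be negative; in that case the bound at `x` is at most `0`,
    -- hence below `C * h ^ k`.
    rcases le_or_gt 0 C with hC' | hC'
    · exact hx'.trans (mul_le_mul_of_nonneg_left (pow_le_pow_left₀ hx.1 hx.2 k) hC')
    · have h1 : C * x ^ k ≤ 0 := mul_nonpos_of_nonpos_of_nonneg hC'.le (pow_nonneg hx.1 k)
      exact (hx'.trans h1).trans hC0
  have := (convex_Icc 0 h).norm_image_sub_le_of_norm_hasDerivWithin_le
    (fun x hx => (hw x (hsub hx)).mono hsub) hbd (Set.left_mem_Icc.2 hh0) (Set.right_mem_Icc.2 hh0)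
  rw [h0, sub_zero, sub_zero, Real.norm_of_nonneg hh0] at this
  rwa [Real.norm_of_nonneg (pow_nonneg hh0 _), pow_succ, ← mul_assoc]

/-- If the derivative is `O(‖x - a‖ ^ k)` near `a`, the function is `O(‖x - a‖ ^ (k + 1))`. -/
theorem isBigO_norm_pow_succ_of_hasFDerivAt {F : Type*} [NormedAddCommGroup F] [NormedSpace ℝ F]
    {w : E → F} {w' : E → E →L[ℝ] F} {a : E} (hw : ∀ᶠ x in 𝓝 a, HasFDerivAt w (w' x) x)
    (ha : w a = 0) {k : ℕ} (hO : w' =O[𝓝 a] fun x => ‖x - a‖ ^ k) :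
    w =O[𝓝 a] fun x => ‖x - a‖ ^ (k + 1) := by
  obtain ⟨C, hC0, hC⟩ := hO.exists_nonneg
  obtain ⟨δ, hδ, H⟩ := Metric.eventually_nhds_iff.1 (hw.and hC.bound)
  refine IsBigO.of_bound C (Metric.eventually_nhds_iff.2 ⟨δ, hδ, fun x hx => ?_⟩)
  rw [dist_eq_norm] at hx
  have hball : ∀ z ∈ Metric.closedBall a ‖x - a‖, dist z a < δ := fun z hz => hz.trans_lt hx
  have hbd : ∀ z ∈ Metric.closedBall a ‖x - a‖, ‖w' z‖ ≤ C * ‖x - a‖ ^ k := by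
    intro z hz
    refine (H (hball z hz)).2.trans (mul_le_mul_of_nonneg_left ?_ hC0)
    rw [norm_pow, norm_norm, ← dist_eq_norm]
    exact pow_le_pow_left₀ dist_nonneg hz k
  have := (convex_closedBall a ‖x - a‖).norm_image_sub_le_of_norm_hasFDerivWithin_le
    (fun z hz => (H (hball z hz)).1.hasFDerivWithinAt) hbd
    (Metric.mem_closedBall_self (norm_nonneg _)) (by rw [Metric.mem_closedBall, dist_eq_norm])
  rw [ha, sub_zero] at this
  rwa [norm_pow, norm_norm, pow_succ, ← mul_assoc]

/-- `L` and `B` are the first two derivatives of `f` at `a`, with third-order Taylor remainder. -/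
structure HasTaylorTwo (f : E → E) (a : E) (L : E →L[ℝ] E) (B : E →L[ℝ] E →L[ℝ] E) : Prop where
  zeroth : (fun x => f x - f a) =O[𝓝 a] fun x => ‖x - a‖
  first : (fun x => f x - f a - L (x - a)) =O[𝓝 a] fun x => ‖x - a‖ ^ 2
  second : (fun x => f x - f a - L (x - a) - (1 / 2 : ℝ) • B (x - a) (x - a))
    =O[𝓝 a] fun x => ‖x - a‖ ^ 3

/-- The derivative of each Taylor remainder of `f` is the remainder of `fderiv ℝ f` of one order
less, so `isBigO_norm_pow_succ_of_hasFDerivAt` climbs from differentiability of the second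
derivative up to the cubic remainder. -/
theorem ContDiff.hasTaylorTwo {f : E → E} (hf : ContDiff ℝ 3 f) (a : E) :
    HasTaylorTwo f a (fderiv ℝ f a) (fderiv ℝ (fderiv ℝ f) a) := by
  have hf1 : ContDiff ℝ 2 (fderiv ℝ f) := hf.fderiv_right (by norm_num)
  have hf2 : ContDiff ℝ 1 (fderiv ℝ (fderiv ℝ f)) := hf1.fderiv_right (by norm_num)
  have hd0 : ∀ x, HasFDerivAt f (fderiv ℝ f x) x := fun x =>
    (hf.differentiable (by norm_num) x).hasFDerivAt
  have hd1 : ∀ x, HasFDerivAt (fderiv ℝ f) (fderiv ℝ (fderiv ℝ f) x) x := fun x =>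
    (hf1.differentiable (by norm_num) x).hasFDerivAt
  have hd2 : ∀ x, HasFDerivAt (fderiv ℝ (fderiv ℝ f)) (fderiv ℝ (fderiv ℝ (fderiv ℝ f)) x) x :=
    fun x => (hf2.differentiable (by norm_num) x).hasFDerivAt
  have hid : ∀ x : E, HasFDerivAt (fun x => x - a) (ContinuousLinearMap.id ℝ E) x := fun x =>
    (hasFDerivAt_id x).sub_const a
  -- Symmetry of the second derivative makes `B (x - a)` the derivative of `(1 / 2) • B (x - a) (x -
  -- a)`.
  have hsymm : ∀ v w, fderiv ℝ (fderiv ℝ f) a v w = fderiv ℝ (fderiv ℝ f) a w v :=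
    (hf.contDiffAt.isSymmSndFDerivAt (by simp; norm_num)).eq
  set L := fderiv ℝ f a
  set B := fderiv ℝ (fderiv ℝ f) a
  have e2 : (fun x => fderiv ℝ (fderiv ℝ f) x - B) =O[𝓝 a] fun x => ‖x - a‖ := by
    simpa using (hd2 a).isBigO_sub.norm_right
  have e1 : (fun x => fderiv ℝ f x - L) =O[𝓝 a] fun x => ‖x - a‖ := by
    simpa using (hd1 a).isBigO_sub.norm_right
  have e1' : (fun x => fderiv ℝ f x - L - B (x - a)) =O[𝓝 a] fun x => ‖x - a‖ ^ 2 := by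
    refine isBigO_norm_pow_succ_of_hasFDerivAt (k := 1) (Eventually.of_forall fun x => ?_)
      (by simp [L]) (by simpa using e2)
    exact ((hd1 x).sub_const L).sub (B.hasFDerivAt.comp x (hid x))
  refine ⟨(hd0 a).isBigO_sub.norm_right, ?_, ?_⟩
  · refine isBigO_norm_pow_succ_of_hasFDerivAt (k := 1) (Eventually.of_forall fun x => ?_)
      (by simp) (by simpa using e1)
    exact ((hd0 x).sub_const (f a)).sub (L.hasFDerivAt.comp x (hid x))
  · refine isBigO_norm_pow_succ_of_hasFDerivAt (k := 2) (Eventually.of_forall fun x => ?_)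
      (by simp) e1'
    have hB := (((B.hasFDerivAt.comp x (hid x)).clm_apply (hid x)).const_smul (1 / 2 : ℝ))
    refine ((((hd0 x).sub_const (f a)).sub (L.hasFDerivAt.comp x (hid x))).sub hB).congr_fderiv ?_
    ext v
    simp only [sub_apply, smul_apply,
      add_apply, ContinuousLinearMap.comp_apply, ContinuousLinearMap.flip_apply,
      ContinuousLinearMap.id_apply, Function.comp_apply]
    rw [hsymm v (x - a)]
    module

namespace HasTaylorTwo

variable {f : E → E} {a : E} {L : E →L[ℝ] E} {B : E →L[ℝ] E →L[ℝ] E}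
  {α : Type*} {l : Filter α} {H : α → ℝ} {x : α → E}

theorem tendsto_of_isBigO {α G : Type*} {l : Filter α} {H : α → ℝ} [NormedAddCommGroup G]
    {x : α → G} {a : G} (hH : Tendsto H l (𝓝 0)) (hx : (fun p => x p - a) =O[l] H) : Tendsto x l (𝓝 a) := by
  have := hx.trans_tendsto hH
  simpa using this.add_const a

theorem comp_zeroth (h : HasTaylorTwo f a L B) (hH : Tendsto H l (𝓝 0))
    (hx : (fun p => x p - a) =O[l] H) : (fun p => f (x p) - f a) =O[l] H :=
  (h.zeroth.comp_tendsto (tendsto_of_isBigO hH hx)).trans hx.norm_left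

theorem isBigO_sub_of_first (hH : Tendsto H l (𝓝 0)) {v : E}
    (hx : (fun p => x p - a - H p • v) =O[l] fun p => H p ^ 2) :
    (fun p => x p - a) =O[l] H := by
  have h1 : (fun p => H p ^ 2) =O[l] H := by
    simpa [sq] using (isBigO_refl H l).mul (hH.isBigO_one ℝ)
  have h2 : (fun p => H p • v) =O[l] H := by
    simpa using (isBigO_refl H l).smul (isBigO_const_const v (one_ne_zero (α := ℝ)) l)
  simpa using (hx.trans h1).add h2

theorem isBigO_sub_of_second (hH : Tendsto H l (𝓝 0)) {v w : E}
    (hx : (fun p => x p - a - H p • v - H p ^ 2 • w) =O[l] fun p => H p ^ 3) :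
    (fun p => x p - a - H p • v) =O[l] fun p => H p ^ 2 := by
  have h1 : (fun p => H p ^ 3) =O[l] fun p => H p ^ 2 := by
    simpa [pow_succ _ 2] using (isBigO_refl (fun p => H p ^ 2) l).mul (hH.isBigO_one ℝ)
  have h2 : (fun p => H p ^ 2 • w) =O[l] fun p => H p ^ 2 := by
    simpa using (isBigO_refl (fun p => H p ^ 2) l).smul
      (isBigO_const_const w (one_ne_zero (α := ℝ)) l)
  simpa using (hx.trans h1).add h2

theorem comp_first (h : HasTaylorTwo f a L B) (hH : Tendsto H l (𝓝 0)) {v : E}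
    (hx : (fun p => x p - a - H p • v) =O[l] fun p => H p ^ 2) :
    (fun p => f (x p) - f a - H p • L v) =O[l] fun p => H p ^ 2 := by
  have hx1 := isBigO_sub_of_first hH hx
  have h1 := (h.first.comp_tendsto (tendsto_of_isBigO hH hx1)).trans (hx1.norm_left.pow 2)
  have h2 := (L.isBigO_comp _ l).trans hx
  refine (h1.add h2).congr_left fun p => ?_
  simp only [Function.comp_apply, map_sub, map_smul]
  abel

theorem comp_second (h : HasTaylorTwo f a L B) (hH : Tendsto H l (𝓝 0)) {v w : E}
    (hx : (fun p => x p - a - H p • v - H p ^ 2 • w) =O[l] fun p => H p ^ 3) :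
    (fun p => f (x p) - f a - H p • L v - H p ^ 2 • (L w + (1 / 2 : ℝ) • B v v))
      =O[l] fun p => H p ^ 3 := by
  have hx2 := isBigO_sub_of_second hH hx
  have hx1 := isBigO_sub_of_first hH hx2
  have h1 := (h.second.comp_tendsto (tendsto_of_isBigO hH hx1)).trans (hx1.norm_left.pow 3)
  have h2 := (L.isBigO_comp _ l).trans hx
  have hbil : ∀ {y z : α → E} {m k : ℕ}, y =O[l] (fun p => H p ^ m) → z =O[l] (fun p => H p ^ k) →
      (fun p => B (y p) (z p)) =O[l] fun p => H p ^ (m + k) := by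
    intro y z m k hy hz
    have : (fun p => B (y p) (z p)) =O[l] fun p => ‖y p‖ * ‖z p‖ :=
      IsBigO.of_bound ‖B‖ (Eventually.of_forall fun p => by
        simpa [mul_assoc] using B.le_opNorm₂ (y p) (z p))
    simpa [pow_add] using this.trans (hy.norm_left.mul hz.norm_left)
  have hv : (fun p => H p • v) =O[l] fun p => H p ^ 1 := by
    simpa using (isBigO_refl H l).smul (isBigO_const_const v (one_ne_zero (α := ℝ)) l)
  -- With `d = x - a`, the quadratic error splits as `B d d - B (H v) (H v) = B (d - H v) d + B (H
  -- v) (d - H v)`, and each summand is `O(H ^ 3)`.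
  have h3 := hbil (m := 2) (k := 1) hx2 (z := fun p => x p - a) (by simpa using hx1)
  have h4 := hbil (m := 1) (k := 2) hv hx2
  refine ((h1.add h2).add ((h3.add h4).const_smul_left (1 / 2 : ℝ))).congr_left fun p => ?_
  simp only [Function.comp_apply, Pi.smul_apply, map_sub, map_smul, sub_apply,
    smul_apply]
  module

end HasTaylorTwo

end Expansion

/-! ### Partitioned Runge–Kutta schemes: expansions, order conditions, solvability -/

section Partitioned

variable {E : Type*} [NormedAddCommGroup E] [NormedSpace ℝ E]

theorem HasTaylorTwo.sum {κ : Type*} [Fintype κ] {f : κ → E → E} {a : E} {L : κ → E →L[ℝ] E}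
    {B : κ → E →L[ℝ] E →L[ℝ] E} (h : ∀ σ, HasTaylorTwo (f σ) a (L σ) (B σ)) :
    HasTaylorTwo (fun x => ∑ σ, f σ x) a (∑ σ, L σ) (∑ σ, B σ) := by
  refine ⟨?_, ?_, ?_⟩
  · refine (IsBigO.fun_sum fun σ (_ : σ ∈ Finset.univ) => (h σ).zeroth).congr_left fun x => ?_
    simp only [Finset.sum_sub_distrib]
  · refine (IsBigO.fun_sum fun σ (_ : σ ∈ Finset.univ) => (h σ).first).congr_left fun x => ?_
    simp only [Finset.sum_sub_distrib, sum_apply]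
  · refine (IsBigO.fun_sum fun σ (_ : σ ∈ Finset.univ) => (h σ).second).congr_left fun x => ?_
    simp only [Finset.sum_sub_distrib, sum_apply, Finset.smul_sum]

/-- Third-order Taylor expansion of the solution of `u' = g u`, `u 0 = u₀`. -/
theorem HasTaylorTwo.solution_expansion {g : E → E} {u₀ : E} {L : E →L[ℝ] E}
    {B : E →L[ℝ] E →L[ℝ] E} (hg : HasTaylorTwo g u₀ L B) {T : ℝ} (hT : 0 < T) {u : ℝ → E}
    (h0 : u 0 = u₀) (hu : ∀ h ∈ Set.Icc 0 T, HasDerivWithinAt u (g (u h)) (Set.Icc 0 T) h) :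
    (fun h => u h - u₀ - h • g u₀ - h ^ 2 • ((1 / 2 : ℝ) • L (g u₀))
      - h ^ 3 • ((1 / 6 : ℝ) • (L (L (g u₀)) + B (g u₀) (g u₀)))) =O[𝓝[≥] 0] fun h => h ^ 4 := by
  have hH : Tendsto (fun h : ℝ => h) (𝓝[≥] 0) (𝓝 0) := tendsto_id.mono_left nhdsWithin_le_nhds
  have hpow : ∀ (k : ℕ) (v : E) (s : Set ℝ) (h : ℝ),
      HasDerivWithinAt (fun h => h ^ (k + 1) • v) (h ^ k • (((k : ℝ) + 1) • v)) s h := by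
    intro k v s h
    refine ((hasDerivAt_pow (k + 1) h).hasDerivWithinAt.smul_const v).congr_deriv ?_
    rw [smul_smul, mul_comm]
    simp
  have e1 : (fun h => u h - u₀) =O[𝓝[≥] 0] fun h : ℝ => h := by
    have := (hu 0 (Set.left_mem_Icc.2 hT.le)).hasFDerivWithinAt.isBigO_sub
    rw [nhdsWithin_Icc_eq_nhdsGE hT] at this
    simpa [h0] using this
  -- An expansion of `u` gives one of `g u = u'` to the same order; integrating gains one power of
  -- `h`. The same move is made twice more.
  have e2 : (fun h => u h - u₀ - h • g u₀) =O[𝓝[≥] 0] fun h : ℝ => h ^ 2 := by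
    refine isBigO_pow_succ_of_hasDerivWithinAt (k := 1) hT (fun h hh => ?_) (by simp [h0])
      ((hg.comp_zeroth hH e1).trans (by simpa using isBigO_refl _ _))
    have := hpow 0 (g u₀) (Set.Icc 0 T) h
    simp only [zero_add, pow_one, pow_zero, one_smul, Nat.cast_zero] at this
    exact ((hu h hh).sub_const u₀).sub this
  have e3 : (fun h => u h - u₀ - h • g u₀ - h ^ 2 • ((1 / 2 : ℝ) • L (g u₀)))
      =O[𝓝[≥] 0] fun h : ℝ => h ^ 3 := by
    refine isBigO_pow_succ_of_hasDerivWithinAt (k := 2) hT (fun h hh => ?_) (by simp [h0])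
      (hg.comp_first hH e2)
    have h1 := hpow 0 (g u₀) (Set.Icc 0 T) h
    have h2 := hpow 1 ((1 / 2 : ℝ) • L (g u₀)) (Set.Icc 0 T) h
    simp only [zero_add, pow_one, pow_zero, one_smul, Nat.cast_zero] at h1
    refine ((((hu h hh).sub_const u₀).sub h1).sub h2).congr_deriv ?_
    push_cast
    module
  refine isBigO_pow_succ_of_hasDerivWithinAt (k := 3) hT (fun h hh => ?_) (by simp [h0])
    (hg.comp_second hH e3)
  have h1 := hpow 0 (g u₀) (Set.Icc 0 T) h
  have h2 := hpow 1 ((1 / 2 : ℝ) • L (g u₀)) (Set.Icc 0 T) h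
  have h3 := hpow 2 ((1 / 6 : ℝ) • (L (L (g u₀)) + B (g u₀) (g u₀))) (Set.Icc 0 T) h
  simp only [zero_add, pow_one, pow_zero, one_smul, Nat.cast_zero] at h1
  refine (((((hu h hh).sub_const u₀).sub h1).sub h2).sub h3).congr_deriv ?_
  push_cast
  rw [map_smul]
  module

variable {κ ι : Type*} [Fintype κ] [Fintype ι]

/-- Stage equations of the partitioned Runge--Kutta scheme with tables `a σ` for the autonomous
system `u' = ∑ σ, f σ u`. -/
def PartitionedStageEq (a : κ → Matrix ι ι ℝ) (f : κ → E → E) (u₀ : E) (H : ℝ) (U : ι → E) :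
    Prop :=
  ∀ i, U i = u₀ + H • ∑ σ, ∑ j, a σ i j • f σ (U j)

namespace PartitionedStageEq

variable {a : κ → Matrix ι ι ℝ} {f : κ → E → E} {u₀ : E} {c : ι → ℝ}
  {α : Type*} {l : Filter α} {H : α → ℝ} {U : α → ι → E}

/-- The factor `H` in the stage equations turns an approximation of the stage tendencies to order
`k` into one of the stages to order `k + 1`. Alternating this with Taylor expansion of `f σ`
bootstraps the expansion of the stages. -/
theorem isBigO_succ (hU : ∀ᶠ p in l, PartitionedStageEq a f u₀ (H p) (U p)) {k : ℕ}
    {q : κ → ι → α → E} (hq : ∀ σ j, (fun p => f σ (U p j) - q σ j p) =O[l] fun p => H p ^ k)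
    (i : ι) :
    (fun p => U p i - u₀ - H p • ∑ σ, ∑ j, a σ i j • q σ j p) =O[l] fun p => H p ^ (k + 1) := by
  have h1 : (fun p => ∑ σ, ∑ j, a σ i j • (f σ (U p j) - q σ j p)) =O[l] fun p => H p ^ k :=
    IsBigO.fun_sum fun σ _ => IsBigO.fun_sum fun j _ => (hq σ j).const_smul_left (a σ i j)
  have h2 := (isBigO_refl H l).smul h1
  refine (h2.congr' ?_ (Eventually.of_forall fun p => ?_))
  · filter_upwards [hU] with p hp
    rw [hp i]
    simp only [smul_sub, Finset.sum_sub_distrib]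
    abel
  · simp [pow_succ, mul_comm]

/-- Expansion of the stages up to third order. -/
theorem expansion {L : κ → E →L[ℝ] E} {B : κ → E →L[ℝ] E →L[ℝ] E}
    (hf : ∀ σ, HasTaylorTwo (f σ) u₀ (L σ) (B σ)) (hrow : ∀ σ i, ∑ j, a σ i j = c i)
    (hH : Tendsto H l (𝓝 0)) (hU : ∀ᶠ p in l, PartitionedStageEq a f u₀ (H p) (U p))
    (hbd : ∀ σ j, (fun p => f σ (U p j)) =O[l] fun _ => (1 : ℝ)) (i : ι) :
    (fun p => U p i - u₀ - H p • c i • (∑ σ, f σ u₀)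
      - H p ^ 2 • (∑ σ, ∑ j, (a σ i j * c j) • L σ (∑ ν, f ν u₀))
      - H p ^ 3 • (∑ σ, ∑ j, a σ i j •
        (L σ (∑ ν, ∑ k, (a ν j k * c k) • L ν (∑ ν, f ν u₀))
          + (1 / 2 : ℝ) • B σ (c j • ∑ ν, f ν u₀) (c j • ∑ ν, f ν u₀))))
      =O[l] fun p => H p ^ 4 := by
  set g := ∑ σ, f σ u₀ with hg
  have hsum : ∀ i, ∑ σ, ∑ j, a σ i j • f σ u₀ = c i • g := by
    intro i
    simp only [← Finset.sum_smul, hrow, hg, Finset.smul_sum]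
  -- The bootstrap starts from bounded tendencies alone, compared with `q = 0`.
  have e1 : ∀ i, (fun p => U p i - u₀) =O[l] H := by
    intro i
    simpa using isBigO_succ (k := 0) (q := 0) hU (by simpa using hbd) i
  have e2 : ∀ i, (fun p => U p i - u₀ - H p • c i • g) =O[l] fun p => H p ^ 2 := by
    intro i
    have := isBigO_succ (k := 1) (q := fun σ _ _ => f σ u₀) hU
      (fun σ j => by simpa using (hf σ).comp_zeroth hH (e1 j)) i
    simpa only [hsum] using this
  have e3 : ∀ i, (fun p => U p i - u₀ - H p • c i • g
      - H p ^ 2 • (∑ σ, ∑ j, (a σ i j * c j) • L σ g)) =O[l] fun p => H p ^ 3 := by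
    intro i
    have := isBigO_succ (k := 2) (q := fun σ j p => f σ u₀ + H p • L σ (c j • g)) hU
      (fun σ j => by simpa only [sub_sub] using (hf σ).comp_first hH (e2 j)) i
    refine this.congr_left fun p => ?_
    simp only [smul_add, Finset.sum_add_distrib, hsum, map_smul]
    simp only [smul_comm (a _ _ _) (H p), ← Finset.smul_sum, smul_smul (a _ _ _)]
    module
  have := isBigO_succ (k := 3) (q := fun σ j p => f σ u₀ + H p • L σ (c j • g) + H p ^ 2 •
      (L σ (∑ ν, ∑ k, (a ν j k * c k) • L ν g) + (1 / 2 : ℝ) • B σ (c j • g) (c j • g))) hU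
      (fun σ j => by simpa only [sub_sub, add_assoc] using (hf σ).comp_second hH (e3 j)) i
  refine this.congr_left fun p => ?_
  have h1 : ∀ (x y z : κ → ι → E), ∑ σ, ∑ j, a σ i j • (x σ j + H p • y σ j + H p ^ 2 • z σ j) =
      ∑ σ, ∑ j, a σ i j • x σ j + H p • ∑ σ, ∑ j, a σ i j • y σ j
        + H p ^ 2 • ∑ σ, ∑ j, a σ i j • z σ j := by
    intro x y z
    simp only [smul_add, Finset.sum_add_distrib, Finset.smul_sum, smul_comm (a _ _ _)]
  rw [h1, hsum]
  have h2 : ∑ σ, ∑ j, a σ i j • L σ (c j • g) = ∑ σ, ∑ j, (a σ i j * c j) • L σ g := by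
    simp only [map_smul, smul_smul]
  rw [h2]
  module

/-- The order conditions for order three, at a stage `e` which serves as the result of the step. -/
theorem sub_solution_isBigO {T : ℝ} (hf : ∀ σ, ContDiff ℝ 3 (f σ))
    (hrow : ∀ σ i, ∑ j, a σ i j = c i) {e : ι} (hc : c e = 1)
    (h2 : ∀ σ, ∑ j, a σ e j * c j = 1 / 2) (h3 : ∀ σ, ∑ j, a σ e j * c j ^ 2 = 1 / 3)
    (h4 : ∀ σ ν, ∑ j, a σ e j * ∑ k, a ν j k * c k = 1 / 6)
    (hH : Tendsto H l (𝓝[>] 0)) (hU : ∀ᶠ p in l, PartitionedStageEq a f u₀ (H p) (U p))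
    (hbd : ∀ σ j, (fun p => f σ (U p j)) =O[l] fun _ => (1 : ℝ))
    (hT : 0 < T) {u : ℝ → E} (h0 : u 0 = u₀)
    (hu : ∀ h ∈ Set.Icc 0 T, HasDerivWithinAt u (∑ σ, f σ (u h)) (Set.Icc 0 T) h) :
    (fun p => U p e - u (H p)) =O[l] fun p => H p ^ 4 := by
  have hf' := fun σ => (hf σ).hasTaylorTwo u₀
  have h5 := (HasTaylorTwo.sum hf').solution_expansion hT h0 hu
  have h6 := h5.comp_tendsto (hH.mono_right (nhdsWithin_mono _ Set.Ioi_subset_Ici_self))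
  have h7 := expansion hf' hrow (hH.mono_right nhdsWithin_le_nhds) hU hbd e
  refine (h7.sub h6).congr_left fun p => ?_
  simp only [Function.comp_apply, hc, sum_apply]
  set g := ∑ σ, f σ u₀ with hg
  set L := fun σ => fderiv ℝ (f σ) u₀
  set B := fun σ => fderiv ℝ (fderiv ℝ (f σ)) u₀
  have k1 : ∑ σ, ∑ j, (a σ e j * c j) • L σ g = (1 / 2 : ℝ) • ∑ σ, L σ g := by
    simp only [← Finset.sum_smul, h2, Finset.smul_sum]
  -- The two third-order elementary differentials: `L L g` is matched by `h4` for every pair of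
  -- tables, and `B g g` by `h3`, since `1/2 * 1/3 = 1/6`.
  have k2 : ∑ σ, ∑ j, a σ e j • (L σ (∑ ν, ∑ k, (a ν j k * c k) • L ν g)
      + (1 / 2 : ℝ) • B σ (c j • g) (c j • g))
      = (1 / 6 : ℝ) • (∑ σ, L σ (∑ ν, L ν g) + ∑ σ, B σ g g) := by
    rw [← Finset.sum_add_distrib, Finset.smul_sum]
    refine Finset.sum_congr rfl fun σ _ => ?_
    rw [smul_add]
    simp only [smul_add, Finset.sum_add_distrib]
    congr 1
    · simp only [← Finset.sum_smul, map_sum, map_smul, Finset.smul_sum, smul_smul]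
      rw [Finset.sum_comm]
      refine Finset.sum_congr rfl fun ν _ => ?_
      rw [← Finset.sum_smul, h4]
    · simp only [map_smul, smul_apply, smul_smul]
      rw [← Finset.sum_smul]
      congr 1
      rw [show (1 / 6 : ℝ) = 1 / 2 * (1 / 3) by norm_num, ← h3 σ, Finset.mul_sum]
      exact Finset.sum_congr rfl fun j _ => by ring
  rw [k1, k2]
  module

/-- For small step sizes the stage equations have a solution near the initial value. -/
theorem exists_solution [CompleteSpace E] {r : ℝ} (hr : 0 < r) {K : NNReal}
    (hK : ∀ σ, LipschitzOnWith K (f σ) (Metric.closedBall u₀ r)) :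
    ∃ H₀ > 0, ∀ H : ℝ, 0 < H → H < H₀ →
      ∃ U : ι → E, (∀ i, ‖U i - u₀‖ ≤ r) ∧ PartitionedStageEq a f u₀ H U := by
  obtain ⟨A, hA0, hA⟩ : ∃ A : ℝ, 0 ≤ A ∧ ∀ i, ∑ σ, ∑ j, |a σ i j| ≤ A := by
    refine ⟨∑ i, ∑ σ, ∑ j, |a σ i j|, by positivity, fun i => ?_⟩
    exact Finset.single_le_sum (f := fun i => ∑ σ, ∑ j, |a σ i j|) (fun _ _ => by positivity)
      (Finset.mem_univ i)
  obtain ⟨N, hN0, hN⟩ : ∃ N : ℝ, 0 ≤ N ∧ ∀ σ, ‖f σ u₀‖ ≤ N := by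
    refine ⟨∑ σ, ‖f σ u₀‖, by positivity, fun σ => ?_⟩
    exact Finset.single_le_sum (f := fun σ => ‖f σ u₀‖) (fun _ _ => norm_nonneg _)
      (Finset.mem_univ σ)
  have key : ∀ (i : ι) (D : ℝ) (x : κ → ι → E), 0 ≤ D → (∀ σ j, ‖x σ j‖ ≤ D) →
      ‖∑ σ, ∑ j, a σ i j • x σ j‖ ≤ A * D := by
    intro i D x hD hx
    refine le_trans ?_ (mul_le_mul_of_nonneg_right (hA i) hD)
    rw [Finset.sum_mul]
    refine norm_sum_le_of_le _ fun σ _ => ?_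
    rw [Finset.sum_mul]
    refine norm_sum_le_of_le _ fun j _ => ?_
    rw [norm_smul, Real.norm_eq_abs]
    exact mul_le_mul_of_nonneg_left (hx σ j) (abs_nonneg _)
  have hP1 : 0 < 2 * A * K + 1 := by positivity
  have hP2 : 0 < A * (N + K * r) + 1 := by positivity
  -- The first bound makes the fixed-point map a contraction with constant `1/2`, the second keeps
  -- it inside the ball; the added `1` keeps both denominators positive.
  refine ⟨min (1 / (2 * A * K + 1)) (r / (A * (N + K * r) + 1)), by positivity, ?_⟩
  intro H hH hH'
  have hH1 : H * (A * K) ≤ 1 / 2 := by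
    have := (lt_div_iff₀ hP1).1 (lt_min_iff.1 hH').1
    nlinarith
  have hH2 : H * (A * (N + K * r)) ≤ r := by
    have := (lt_div_iff₀ hP2).1 (lt_min_iff.1 hH').2
    nlinarith
  let Φ : (ι → E) → ι → E := fun U i => u₀ + H • ∑ σ, ∑ j, a σ i j • f σ (U j)
  let s : Set (ι → E) := Metric.closedBall (fun _ => u₀) r
  have hs : ∀ U ∈ s, ∀ i, U i ∈ Metric.closedBall u₀ r := fun U hU i =>
    (dist_le_pi_dist U (fun _ => u₀) i).trans hU
  have hmaps : Set.MapsTo Φ s s := by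
    intro U hU
    refine (dist_pi_le_iff hr.le).2 fun i => ?_
    rw [dist_eq_norm]
    simp only [Φ, add_sub_cancel_left]
    rw [norm_smul, Real.norm_of_nonneg hH.le]
    refine (mul_le_mul_of_nonneg_left (key i (N + K * r) _ (by positivity) fun σ j => ?_)
      hH.le).trans hH2
    have h1 := (hK σ).norm_sub_le (hs U hU j) (Metric.mem_closedBall_self hr.le)
    have h2 : (K : ℝ) * ‖U j - u₀‖ ≤ K * r :=
      mul_le_mul_of_nonneg_left (by rw [← dist_eq_norm]; exact hs U hU j) K.2
    have h3 := norm_le_norm_add_norm_sub' (f σ (U j)) (f σ u₀)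
    linarith [hN σ]
  have hcontr : ContractingWith (1 / 2) (hmaps.restrict Φ s s) := by
    refine ⟨by norm_num, LipschitzWith.of_dist_le_mul fun U V => ?_⟩
    rw [Subtype.dist_eq, Subtype.dist_eq]
    refine (dist_pi_le_iff (by positivity)).2 fun i => ?_
    rw [dist_eq_norm]
    simp only [Set.MapsTo.val_restrict_apply, Φ, add_sub_add_left_eq_sub, ← smul_sub,
      ← Finset.sum_sub_distrib]
    rw [norm_smul, Real.norm_of_nonneg hH.le]
    have := key i (K * dist U.1 V.1) (fun σ j => f σ (U.1 j) - f σ (V.1 j)) (by positivity)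
      fun σ j => by
        refine ((hK σ).norm_sub_le (hs U.1 U.2 j) (hs V.1 V.2 j)).trans ?_
        rw [← dist_eq_norm]
        exact mul_le_mul_of_nonneg_left (dist_le_pi_dist U.1 V.1 j) K.2
    refine (mul_le_mul_of_nonneg_left this hH.le).trans ?_
    have h1 := mul_le_mul_of_nonneg_right hH1 (dist_nonneg (x := U.1) (y := V.1))
    push_cast
    linarith
  obtain ⟨U, hU, hfix, -⟩ := hcontr.exists_fixedPoint' (Metric.isClosed_closedBall.isComplete)
    hmaps (x := fun _ => u₀) (Metric.mem_closedBall_self hr.le) (edist_ne_top _ _)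
  refine ⟨U, fun i => ?_, fun i => ?_⟩
  · rw [← dist_eq_norm]
    exact hs U hU i
  · exact (congrFun hfix i).symm

end PartitionedStageEq

end Partitioned

/-! ### Extracting algebraic order conditions from the analytic order -/

section OrderConditions

/-- Divide by `H ^ m` and let `H` tend to `0`. This converts a local error that is an explicit
monomial with coefficient `D` into the order condition `D = 0`. -/
theorem eq_zero_of_forall_pow_mul_le {D C H₀ : ℝ} {m q : ℕ} (hmq : m < q) (hH₀ : 0 < H₀)
    (h : ∀ H, 0 < H → H < H₀ → |H ^ m * D| ≤ C * H ^ q) : D = 0 := by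
  obtain ⟨k, rfl⟩ : ∃ k, q = m + (k + 1) := ⟨q - m - 1, by omega⟩
  have hle : ∀ᶠ H in 𝓝[>] (0 : ℝ), |D| ≤ C * H ^ (k + 1) := by
    filter_upwards [Ioo_mem_nhdsGT hH₀] with H hH
    have h1 := h H hH.1 hH.2
    have h2 : 0 < H ^ m := pow_pos hH.1 m
    rw [abs_mul, abs_of_pos h2, pow_add] at h1
    refine le_of_mul_le_mul_left (h1.trans_eq ?_) h2
    ring
  have hlim : Tendsto (fun H : ℝ => C * H ^ (k + 1)) (𝓝[>] 0) (𝓝 0) := by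
    have : Continuous fun H : ℝ => C * H ^ (k + 1) := by fun_prop
    simpa using (this.tendsto 0).mono_left nhdsWithin_le_nhds
  exact abs_nonpos_iff.1 (ge_of_tendsto hlim hle)

/-- The right-hand side `(α t ^ k, β y₀)`, for which quadrature and coupling conditions show up as
local errors. -/
def quadratureRHS (k : ℕ) (α β : ℝ) (t : ℝ) (y : Fin 2 → ℝ) : Fin 2 → ℝ :=
  ![α * t ^ k, β * y 0]

theorem smoothRHS_quadratureRHS (k : ℕ) (α β : ℝ) : SmoothRHS (quadratureRHS k α β) := by
  unfold SmoothRHS quadratureRHS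
  rw [contDiff_pi]
  intro i
  fin_cases i
  · exact contDiff_const.mul (contDiff_fst.pow k)
  · exact contDiff_const.mul ((contDiff_apply ℝ ℝ (0 : Fin 2)).comp contDiff_snd)

theorem isSolutionIVP_quadratureRHS (k : ℕ) (αE βE αI βI : ℝ) :
    IsSolutionIVP (fun t y => quadratureRHS k αE βE t y + quadratureRHS k αI βI t y) 0 1 0
      (fun t => ![(αE + αI) / (k + 1) * t ^ (k + 1),
        (βE + βI) * (αE + αI) / ((k + 1) * (k + 2)) * t ^ (k + 2)]) := by
  have hk1 : (k : ℝ) + 1 ≠ 0 := by positivity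
  have hk2 : (k : ℝ) + 2 ≠ 0 := by positivity
  refine ⟨by ext i; fin_cases i <;> simp, fun t _ => HasDerivAt.hasDerivWithinAt ?_⟩
  rw [hasDerivAt_pi]
  intro i
  fin_cases i
  · refine ((hasDerivAt_pow (k + 1) t).const_mul ((αE + αI) / (k + 1))).congr_deriv ?_
    simp [quadratureRHS]
    field_simp
  · refine ((hasDerivAt_pow (k + 2) t).const_mul
      ((βE + βI) * (αE + αI) / ((k + 1) * (k + 2)))).congr_deriv ?_
    simp [quadratureRHS]
    field_simp

namespace ARKMethod

variable {s : ℕ} {M : ARKMethod s} {p : ℕ}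

/-- The first component of the right-hand side depends on time only and the second only on the first
component, so even an implicit scheme yields closed formulas: both components of the local error are
a power of `H` times the defect of an order condition. The free coefficients `αE βE αI βI` later
isolate individual tables. -/
theorem HasOrder.exists_quadrature_bound (h : M.HasOrder p) (k : ℕ) (αE βE αI βI : ℝ) :
    ∃ H₀ > 0, ∃ C : ℝ, ∀ H, 0 < H → H < H₀ →
      |H ^ (k + 1) * (αE * ∑ i, M.bE i * M.cE i ^ k + αI * ∑ i, M.bI i * M.cI i ^ k
        - (αE + αI) / (k + 1))| ≤ C * H ^ (p + 1) ∧
      |H ^ (k + 2) * (∑ i, (βE * M.bE i + βI * M.bI i) * (αE * ∑ j, M.AE i j * M.cE j ^ k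
        + αI * ∑ j, M.AI i j * M.cI j ^ k)
        - (βE + βI) * (αE + αI) / ((k + 1) * (k + 2)))| ≤ C * H ^ (p + 1) := by
  obtain ⟨r, hr, H₀, hH₀, C, hC⟩ := h 2 _ _ (smoothRHS_quadratureRHS k αE βE)
    (smoothRHS_quadratureRHS k αI βI) 0 1 0 _ one_pos (isSolutionIVP_quadratureRHS k αE βE αI βI)
  refine ⟨H₀, hH₀, C, fun H hH hH' => ?_⟩
  obtain ⟨⟨Z, hZr, hZ⟩, hall⟩ := hC H hH hH'
  have hbd := hall Z hZr hZ
  have hZ0 : ∀ i, Z i 0 = H ^ (k + 1) * (αE * ∑ j, M.AE i j * M.cE j ^ k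
      + αI * ∑ j, M.AI i j * M.cI j ^ k) := by
    intro i
    rw [hZ i]
    simp only [quadratureRHS, Pi.add_apply, Pi.smul_apply, Finset.sum_apply, smul_eq_mul,
      zero_add, Matrix.cons_val_zero, mul_add, Finset.mul_sum]
    congr 1 <;> exact Finset.sum_congr rfl fun j _ => by ring
  constructor
  · refine le_trans (le_of_eq ?_) ((norm_le_pi_norm _ 0).trans hbd)
    rw [Real.norm_eq_abs]
    congr 1
    simp only [update, quadratureRHS, Pi.add_apply, Pi.sub_apply, Pi.smul_apply, Finset.sum_apply,
      smul_eq_mul, zero_add, Matrix.cons_val_zero, mul_sub, mul_add, Finset.mul_sum]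
    congr 1
    · congr 1 <;> exact Finset.sum_congr rfl fun j _ => by ring
    · ring
  · refine le_trans (le_of_eq ?_) ((norm_le_pi_norm _ 1).trans hbd)
    rw [Real.norm_eq_abs]
    congr 1
    simp only [update, quadratureRHS, Pi.add_apply, Pi.sub_apply, Pi.smul_apply, Finset.sum_apply,
      smul_eq_mul, zero_add, Matrix.cons_val_one, Matrix.cons_val_zero, hZ0, mul_sub]
    congr 1
    · rw [Finset.mul_sum, Finset.mul_sum, Finset.mul_sum, ← Finset.sum_add_distrib]
      exact Finset.sum_congr rfl fun j _ => by ring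
    · ring

theorem HasOrder.quadrature (h : M.HasOrder p) {k : ℕ} (hk : k + 1 ≤ p) (αE αI : ℝ) :
    αE * ∑ i, M.bE i * M.cE i ^ k + αI * ∑ i, M.bI i * M.cI i ^ k = (αE + αI) / (k + 1) := by
  obtain ⟨H₀, hH₀, C, hC⟩ := h.exists_quadrature_bound k αE 0 αI 0
  exact sub_eq_zero.1 (eq_zero_of_forall_pow_mul_le (by omega) hH₀ fun H h1 h2 => (hC H h1 h2).1)

theorem HasOrder.coupling (h : M.HasOrder p) {k : ℕ} (hk : k + 2 ≤ p) (αE βE αI βI : ℝ) :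
    ∑ i, (βE * M.bE i + βI * M.bI i) * (αE * ∑ j, M.AE i j * M.cE j ^ k
      + αI * ∑ j, M.AI i j * M.cI j ^ k) = (βE + βI) * (αE + αI) / ((k + 1) * (k + 2)) := by
  obtain ⟨H₀, hH₀, C, hC⟩ := h.exists_quadrature_bound k αE βE αI βI
  exact sub_eq_zero.1 (eq_zero_of_forall_pow_mul_le (by omega) hH₀ fun H h1 h2 => (hC H h1 h2).2)

end ARKMethod

namespace RKMethod

variable {s : ℕ} (R : RKMethod s) {p : ℕ}

/-- A Runge--Kutta method as an additive method with two equal tables. -/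
def toARK : ARKMethod s := ⟨R.A, R.b, R.c, R.A, R.b, R.c⟩

variable {R}

/-- An additive method with two equal tables sees only `fE + fI`, so the conditions for additive
methods specialize to Runge–Kutta methods. -/
theorem HasOrder.toARK (h : R.HasOrder p) : R.toARK.HasOrder p := by
  intro d fE fI hE hI t₀ T y₀ y hT hy
  have := h d (fun t x => fE t x + fI t x) (ContDiff.add hE hI) t₀ T y₀ y hT hy
  have e1 : R.StageEq (fun t x => fE t x + fI t x) t₀ y₀ = R.toARK.StageEq fE fI t₀ y₀ := by
    funext H Z
    simp only [StageEq, ARKMethod.StageEq, RKMethod.toARK, smul_add, Finset.sum_add_distrib,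
      add_assoc]
  have e2 : R.update (fun t x => fE t x + fI t x) t₀ y₀ = R.toARK.update fE fI t₀ y₀ := by
    funext H Z
    simp only [update, ARKMethod.update, RKMethod.toARK, smul_add, Finset.sum_add_distrib,
      add_assoc]
  rwa [e1, e2] at this

theorem HasOrder.quadrature (h : R.HasOrder p) {k : ℕ} (hk : k + 1 ≤ p) :
    ∑ i, R.b i * R.c i ^ k = 1 / (k + 1) := by
  simpa [RKMethod.toARK] using h.toARK.quadrature hk 1 0

theorem HasOrder.coupling (h : R.HasOrder p) {k : ℕ} (hk : k + 2 ≤ p) :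
    ∑ i, R.b i * ∑ j, R.A i j * R.c j ^ k = 1 / ((k + 1) * (k + 2)) := by
  simpa [RKMethod.toARK] using h.toARK.coupling hk 1 1 0 0

end RKMethod

end OrderConditions

/-! ### Local error, uniformly over all stage solutions near the initial value -/

section LocalError

variable {E : Type*} [NormedAddCommGroup E] [NormedSpace ℝ E]
  {κ ι : Type*} [Fintype κ] [Fintype ι] {a : κ → Matrix ι ι ℝ} {f : κ → E → E} {u₀ : E} {c : ι → ℝ}

theorem exists_lipschitzOnWith_closedBall (hf : ∀ σ, ContDiff ℝ 1 (f σ)) (u₀ : E) :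
    ∃ r > 0, ∃ K : NNReal, ∀ σ, LipschitzOnWith K (f σ) (Metric.closedBall u₀ r) := by
  choose K t ht hK using fun σ => (hf σ).contDiffAt.exists_lipschitzOnWith (x := u₀)
  obtain ⟨r, hr, hsub⟩ := Metric.nhds_basis_closedBall.mem_iff.1 (iInter_mem.2 ht)
  refine ⟨r, hr, ∑ σ, K σ, fun σ => ((hK σ).mono ?_).weaken ?_⟩
  · exact hsub.trans (Set.iInter_subset _ σ)
  · exact Finset.single_le_sum (fun _ _ => zero_le) (Finset.mem_univ σ)

/-- A partitioned Runge--Kutta scheme satisfying the order conditions at the stage `e` has a local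
error of order four. -/
theorem PartitionedStageEq.local_error [CompleteSpace E] {T : ℝ} (hf : ∀ σ, ContDiff ℝ 3 (f σ))
    (hrow : ∀ σ i, ∑ j, a σ i j = c i) {e : ι} (hc : c e = 1)
    (h2 : ∀ σ, ∑ j, a σ e j * c j = 1 / 2) (h3 : ∀ σ, ∑ j, a σ e j * c j ^ 2 = 1 / 3)
    (h4 : ∀ σ ν, ∑ j, a σ e j * ∑ k, a ν j k * c k = 1 / 6)
    (hT : 0 < T) {u : ℝ → E} (h0 : u 0 = u₀)
    (hu : ∀ h ∈ Set.Icc 0 T, HasDerivWithinAt u (∑ σ, f σ (u h)) (Set.Icc 0 T) h) :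
    ∃ r > 0, ∃ H₀ > 0, ∃ C : ℝ, ∀ H : ℝ, 0 < H → H < H₀ →
      (∃ U : ι → E, (∀ i, ‖U i - u₀‖ ≤ r) ∧ PartitionedStageEq a f u₀ H U) ∧
      ∀ U : ι → E, (∀ i, ‖U i - u₀‖ ≤ r) → PartitionedStageEq a f u₀ H U →
        ‖U e - u H‖ ≤ C * H ^ 4 := by
  obtain ⟨r, hr, K, hK⟩ := exists_lipschitzOnWith_closedBall
    (fun σ => (hf σ).of_le (by norm_num)) u₀
  obtain ⟨H₁, hH₁, hex⟩ := exists_solution (a := a) hr hK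
  -- The asymptotics are taken along pairs of a step size and a stage vector, with `H → 0⁺` and the
  -- vector any nearby solution. A single constant then serves all solutions, with no selection of
  -- one per `H`.
  let S : Set (ℝ × (ι → E)) :=
    {q | (∀ i, ‖q.2 i - u₀‖ ≤ r) ∧ PartitionedStageEq a f u₀ q.1 q.2}
  have hS : ∀ᶠ q in comap Prod.fst (𝓝[>] (0 : ℝ)) ⊓ 𝓟 S, q ∈ S :=
    mem_inf_of_right (mem_principal_self S)
  have hO := sub_solution_isBigO (l := comap Prod.fst (𝓝[>] (0 : ℝ)) ⊓ 𝓟 S) (H := Prod.fst)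
    (U := Prod.snd) hf hrow hc h2 h3 h4 (tendsto_comap.mono_left inf_le_left)
    (hS.mono fun q hq => hq.2) (fun σ j => ?_) hT h0 hu
  · obtain ⟨C, hC⟩ := hO.bound
    rw [eventually_inf_principal, eventually_comap, eventually_nhdsWithin_iff,
      Metric.eventually_nhds_iff] at hC
    obtain ⟨δ, hδ, hC⟩ := hC
    refine ⟨r, hr, min H₁ δ, lt_min hH₁ hδ, C, fun H hH hH' => ?_⟩
    rw [lt_min_iff] at hH'
    refine ⟨hex H hH hH'.1, fun U hUr hU => ?_⟩
    have := hC (y := H) (by simpa [abs_of_pos hH] using hH'.2) hH (H, U) rfl ⟨hUr, hU⟩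
    simpa [abs_of_pos hH] using this
  · refine IsBigO.of_bound (‖f σ u₀‖ + K * r) (hS.mono fun q hq => ?_)
    have hq' : q.2 j ∈ Metric.closedBall u₀ r := by
      rw [Metric.mem_closedBall, dist_eq_norm]
      exact hq.1 j
    have h1 := (hK σ).norm_sub_le hq' (Metric.mem_closedBall_self hr.le)
    have h2 : (K : ℝ) * ‖q.2 j - u₀‖ ≤ K * r := mul_le_mul_of_nonneg_left (hq.1 j) K.2
    have h3 := norm_le_norm_add_norm_sub' (f σ (q.2 j)) (f σ u₀)
    rw [norm_one, mul_one]
    linarith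

end LocalError

/-! ### The IMEX-MRI-SR scheme as a partitioned Runge–Kutta scheme -/

namespace IMEXMRISR

variable {n nΩ sF d : ℕ} (M : IMEXMRISR n nΩ) (R : RKMethod sF)

/-- The tables of the scheme, acting on fast and slow stages together. -/
noncomputable def table : Fin 3 → Matrix ((Fin (n + 1) × Fin sF) ⊕ Fin (n + 1))
    ((Fin (n + 1) × Fin sF) ⊕ Fin (n + 1)) ℝ :=
  ![Matrix.fromBlocks (M.AFF R) 0 (M.ASF R) 0, Matrix.fromBlocks 0 (M.AFE R) 0 M.ASE,
    Matrix.fromBlocks 0 (M.AFI R) 0 M.ASI]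

/-- The abscissae of fast and slow stages. -/
def abscissa : (Fin (n + 1) × Fin sF) ⊕ Fin (n + 1) → ℝ :=
  Sum.elim (fun ij => M.c ij.1 * R.c ij.2) M.c

section Tables

variable {V : Type*} [AddCommGroup V] [Module ℝ V]
  (x : (Fin (n + 1) × Fin sF) ⊕ Fin (n + 1) → V)

/-- This and its companions allow values in any module, so that they serve the stage equations with
vector tendencies as well as the scalar row sums and order conditions. -/
theorem sum_table_fast_fast (i : Fin (n + 1)) (j : Fin sF) :
    ∑ k, M.table R 0 (Sum.inl (i, j)) k • x k
      = M.c i • ∑ k, R.A j k • x (Sum.inl (i, k)) := by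
  simp only [table, AFF, Fintype.sum_sum_type, Fintype.sum_prod_type, Matrix.cons_val_zero,
    Matrix.fromBlocks_apply₁₁, Matrix.fromBlocks_apply₁₂,
    Matrix.zero_apply, zero_smul, Finset.sum_const_zero, add_zero]
  rw [Finset.sum_eq_single i (fun l _ hl => by simp [Matrix.diagonal_apply_ne' _ hl]) (by simp)]
  simp [Finset.smul_sum, smul_smul]

theorem sum_table_slow_fast (i : Fin (n + 1)) :
    ∑ k, M.table R 0 (Sum.inr i) k • x k = M.c i • ∑ k, R.b k • x (Sum.inl (i, k)) := by
  simp only [table, ASF, Fintype.sum_sum_type, Fintype.sum_prod_type, Matrix.cons_val_zero,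
    Matrix.fromBlocks_apply₂₁, Matrix.fromBlocks_apply₂₂, Matrix.of_apply,
    Matrix.zero_apply, zero_smul, Finset.sum_const_zero, add_zero]
  rw [Finset.sum_eq_single i (fun l _ hl => by simp [Matrix.diagonal_apply_ne' _ hl]) (by simp)]
  simp [Finset.smul_sum, smul_smul]

theorem sum_table_fast_explicit (ij : Fin (n + 1) × Fin sF) :
    ∑ k, M.table R 1 (Sum.inl ij) k • x k = ∑ l, M.AFE R ij l • x (Sum.inr l) := by
  simp [table, Fintype.sum_sum_type]

theorem sum_table_slow_explicit (i : Fin (n + 1)) :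
    ∑ k, M.table R 1 (Sum.inr i) k • x k = ∑ l, M.Ωbar i l • x (Sum.inr l) := by
  simp [table, Fintype.sum_sum_type, ASE]

theorem sum_table_fast_implicit (ij : Fin (n + 1) × Fin sF) :
    ∑ k, M.table R 2 (Sum.inl ij) k • x k = ∑ l, M.AFE R ij l • x (Sum.inr l) := by
  simp [table, Fintype.sum_sum_type, AFI]

theorem sum_table_slow_implicit (i : Fin (n + 1)) :
    ∑ k, M.table R 2 (Sum.inr i) k • x k = ∑ l, (M.Ωbar + M.Γ) i l • x (Sum.inr l) := by
  simp [table, Fintype.sum_sum_type, ASI]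

end Tables

theorem AFE_apply (i l : Fin (n + 1)) (j : Fin sF) :
    M.AFE R (i, j) l = ∑ k, R.A j k * M.omega i l (R.c k) := by
  simp only [AFE, Matrix.of_apply, Matrix.mulVec, dotProduct, Pi.pow_apply, omega, Finset.mul_sum]
  rw [Finset.sum_comm]
  exact Finset.sum_congr rfl fun k _ => Finset.sum_congr rfl fun m _ => by ring

variable {M R}

/-- `Ωbar` holds the integrals over `[0, 1]` of the polynomials `omega`, which have degree below
`nΩ`; the fast quadrature integrates these exactly. -/
theorem Ωbar_eq_sum_omega (hb : ∀ k < nΩ, ∑ i, R.b i * R.c i ^ k = 1 / (k + 1))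
    (i l : Fin (n + 1)) : M.Ωbar i l = ∑ k, R.b k * M.omega i l (R.c k) := by
  simp only [Ωbar, omega, Finset.mul_sum, Matrix.sum_apply, Matrix.smul_apply, smul_eq_mul]
  rw [Finset.sum_comm]
  refine Finset.sum_congr rfl fun m _ => ?_
  rw [← hb m m.2, Finset.sum_mul]
  exact Finset.sum_congr rfl fun k _ => by ring

theorem omega_eq_zero {i l : Fin (n + 1)} (h : i ≤ l) (τ : ℝ) : M.omega i l τ = 0 :=
  Finset.sum_eq_zero fun k _ => by rw [M.Ω_strictLower k i l h, zero_mul]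

/-- Fast, explicit and implicit parts of the autonomous form of the right-hand side. -/
def autonomousRHS (fF fE fI : ℝ → (Fin d → ℝ) → (Fin d → ℝ)) :
    Fin 3 → ℝ × (Fin d → ℝ) → ℝ × (Fin d → ℝ) :=
  ![fun u => (1, fF u.1 u.2), fun u => (0, fE u.1 u.2), fun u => (0, fI u.1 u.2)]

theorem contDiff_autonomousRHS {fF fE fI : ℝ → (Fin d → ℝ) → (Fin d → ℝ)} (hF : SmoothRHS fF)
    (hE : SmoothRHS fE) (hI : SmoothRHS fI) (σ : Fin 3) :
    ContDiff ℝ 3 (autonomousRHS fF fE fI σ) := by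
  have h3 : (3 : WithTop ℕ∞) ≤ ((⊤ : ℕ∞) : WithTop ℕ∞) :=
    WithTop.coe_le_coe.2 (le_top : (3 : ℕ∞) ≤ ⊤)
  fin_cases σ
  · exact contDiff_const.prodMk (ContDiff.of_le hF h3)
  · exact contDiff_const.prodMk (ContDiff.of_le hE h3)
  · exact contDiff_const.prodMk (ContDiff.of_le hI h3)

/-- Time advances only through the fast part, at rate `1`, so the time component of a stage is
governed by the row sums of table `0`. -/
theorem partitionedStageEq_fst {fF fE fI : ℝ → (Fin d → ℝ) → (Fin d → ℝ)} {t₀ H : ℝ}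
    {y₀ : Fin d → ℝ} {U : (Fin (n + 1) × Fin sF) ⊕ Fin (n + 1) → ℝ × (Fin d → ℝ)}
    (hrow : ∀ i, ∑ j, M.table R 0 i j = M.abscissa R i)
    (hU : PartitionedStageEq (M.table R) (autonomousRHS fF fE fI) (t₀, y₀) H U)
    (i : (Fin (n + 1) × Fin sF) ⊕ Fin (n + 1)) : (U i).1 = t₀ + M.abscissa R i * H := by
  have := congrArg Prod.fst (hU i)
  simpa [Fin.sum_univ_three, Prod.fst_sum, autonomousRHS, hrow, mul_comm,
    -Fintype.sum_sum_type] using this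

/-- With the times prescribed by the abscissae, the time components hold automatically. In the
others, triangularity of `Ω` and `Γ` extends the sums over `l < i` and `l ≤ i` to all `l`, and exact
fast quadrature identifies the slow weights with `Ωbar`. -/
theorem partitionedStageEq_iff {fF fE fI : ℝ → (Fin d → ℝ) → (Fin d → ℝ)} {t₀ H : ℝ}
    {y₀ : Fin d → ℝ} (hrow : ∀ i, ∑ j, M.table R 0 i j = M.abscissa R i)
    (hb : ∀ k < nΩ, ∑ i, R.b i * R.c i ^ k = 1 / (k + 1))
    (Z : (Fin (n + 1) × Fin sF) ⊕ Fin (n + 1) → (Fin d → ℝ)) :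
    PartitionedStageEq (M.table R) (autonomousRHS fF fE fI) (t₀, y₀) H
      (fun i => (t₀ + M.abscissa R i * H, Z i)) ↔ M.StageEq R fF fE fI t₀ y₀ H Z := by
  have hfst : ∀ i, t₀ + M.abscissa R i * H = ((t₀, y₀) + H • ∑ σ, ∑ j, M.table R σ i j •
      autonomousRHS fF fE fI σ (t₀ + M.abscissa R j * H, Z j)).1 := by
    intro i
    simp [Fin.sum_univ_three, Prod.fst_sum, autonomousRHS, hrow, mul_comm, -Fintype.sum_sum_type]
  have hsnd : ∀ i, ((t₀, y₀) + H • ∑ σ, ∑ j, M.table R σ i j •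
      autonomousRHS fF fE fI σ (t₀ + M.abscissa R j * H, Z j)).2
      = y₀ + H • (∑ j, M.table R 0 i j • fF (t₀ + M.abscissa R j * H) (Z j)
        + ∑ j, M.table R 1 i j • fE (t₀ + M.abscissa R j * H) (Z j)
        + ∑ j, M.table R 2 i j • fI (t₀ + M.abscissa R j * H) (Z j)) := by
    intro i
    simp [Fin.sum_univ_three, Prod.snd_sum, autonomousRHS]
  have hslow : ∀ (i : Fin (n + 1)) (w : Fin sF → ℝ) (x : Fin (n + 1) → Fin d → ℝ),
      ∑ k, w k • ∑ l ∈ Finset.Iio i, M.omega i l (R.c k) • x l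
        = ∑ l, (∑ k, w k * M.omega i l (R.c k)) • x l := by
    intro i w x
    simp only [Finset.sum_smul, Finset.smul_sum, smul_smul]
    rw [Finset.sum_comm]
    refine Finset.sum_subset (Finset.subset_univ _) fun l _ hl => ?_
    simp only [Finset.mem_Iio, not_lt] at hl
    simp [omega_eq_zero hl]
  have hΓ : ∀ (i : Fin (n + 1)) (x : Fin (n + 1) → Fin d → ℝ),
      ∑ l ∈ Finset.Iic i, M.Γ i l • x l = ∑ l, M.Γ i l • x l := by
    intro i x
    refine Finset.sum_subset (Finset.subset_univ _) fun l _ hl => ?_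
    simp only [Finset.mem_Iic, not_le] at hl
    rw [M.Γ_lower i l hl, zero_smul]
  have hiff : PartitionedStageEq (M.table R) (autonomousRHS fF fE fI) (t₀, y₀) H
      (fun i => (t₀ + M.abscissa R i * H, Z i)) ↔
      ∀ i, Z i = y₀ + H • (∑ j, M.table R 0 i j • fF (t₀ + M.abscissa R j * H) (Z j)
        + ∑ j, M.table R 1 i j • fE (t₀ + M.abscissa R j * H) (Z j)
        + ∑ j, M.table R 2 i j • fI (t₀ + M.abscissa R j * H) (Z j)) := by
    refine forall_congr' fun i => ?_
    rw [← hsnd, Prod.ext_iff]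
    exact and_iff_right (hfst i)
  rw [hiff, Sum.forall, Prod.forall]
  refine and_congr (forall_congr' fun i => forall_congr' fun j => ?_) (forall_congr' fun i => ?_)
  · rw [sum_table_fast_fast, sum_table_fast_explicit, sum_table_fast_implicit, hslow]
    simp only [abscissa, Sum.elim_inl, Sum.elim_inr, ← AFE_apply, smul_add,
      Finset.sum_add_distrib, smul_smul, mul_comm H, add_assoc]
  · rw [sum_table_slow_fast, sum_table_slow_explicit, sum_table_slow_implicit, hslow, hΓ]
    simp only [abscissa, Sum.elim_inl, Sum.elim_inr, ← Ωbar_eq_sum_omega hb, smul_add,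
      Finset.sum_add_distrib, smul_smul, mul_comm H, add_assoc, Matrix.add_apply, add_smul]

/-- The fast table has these row sums because `R.A` has row sums `R.c` and the weights `R.b` sum to
`1`; internal consistency carries them over to the slow tables. -/
theorem InternallyConsistent.sum_table (hcons : M.InternallyConsistent R)
    (hb : ∑ i, R.b i = 1) (σ : Fin 3) (i : (Fin (n + 1) × Fin sF) ⊕ Fin (n + 1)) :
    ∑ j, M.table R σ i j = M.abscissa R i := by
  obtain ⟨h1, -, h3, h4⟩ := hcons
  have hF : ∀ i, ∑ j, M.table R 0 i j = M.abscissa R i := by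
    rintro (⟨i, j⟩ | i)
    · simpa [abscissa, R.row_sum] using M.sum_table_fast_fast R (fun _ => (1 : ℝ)) i j
    · simpa [abscissa, hb] using M.sum_table_slow_fast R (fun _ => (1 : ℝ)) i
  have hFE : ∀ ij, ∑ l, M.AFE R ij l = ∑ j, M.table R 0 (Sum.inl ij) j := by
    intro ij
    simpa [Matrix.mulVec, dotProduct, table] using (congrFun h1 ij).symm
  have hSE : ∀ i, ∑ l, M.Ωbar i l = ∑ j, M.table R 0 (Sum.inr i) j := by
    intro i
    simpa [Matrix.mulVec, dotProduct, table, ASE] using (congrFun h3 i).symm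
  have hSI : ∀ i, ∑ l, (M.Ωbar + M.Γ) i l = ∑ l, M.Ωbar i l := by
    intro i
    simpa [Matrix.mulVec, dotProduct, table, ASE, ASI] using (congrFun h4 i).symm
  fin_cases σ
  · exact hF i
  · rcases i with ij | i
    · have := M.sum_table_fast_explicit R (fun _ => (1 : ℝ)) ij
      simp only [smul_eq_mul, mul_one] at this
      exact this.trans ((hFE ij).trans (hF _))
    · have := M.sum_table_slow_explicit R (fun _ => (1 : ℝ)) i
      simp only [smul_eq_mul, mul_one] at this
      exact this.trans ((hSE i).trans (hF _))
  · rcases i with ij | i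
    · have := M.sum_table_fast_implicit R (fun _ => (1 : ℝ)) ij
      simp only [smul_eq_mul, mul_one] at this
      exact this.trans ((hFE ij).trans (hF _))
    · have := M.sum_table_slow_implicit R (fun _ => (1 : ℝ)) i
      simp only [smul_eq_mul, mul_one] at this
      exact this.trans ((hSI i).trans ((hSE i).trans (hF _)))

end IMEXMRISR

/-! ### Order conditions of the coupled scheme -/

namespace IMEXMRISR

variable {n nΩ sF d : ℕ} {M : IMEXMRISR n nΩ} {R : RKMethod sF}

/-- The order conditions up to order three of the coupled scheme at its last slow stage. -/
theorem order_conditions (hrow : ∀ σ i, ∑ j, M.table R σ i j = M.abscissa R i)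
    (hslow : M.slowBase.HasOrder 3)
    (hb : ∀ k < max 3 (nΩ + 1), ∑ i, R.b i * R.c i ^ k = 1 / (k + 1))
    (hbA : ∀ k, k + 1 < max 3 (nΩ + 1) →
      ∑ i, R.b i * ∑ j, R.A i j * R.c j ^ k = 1 / ((k + 1) * (k + 2)))
    (hcoupling : ∑ l, (∑ k : Fin nΩ, 1 / (((k : ℝ) + 1) * ((k : ℝ) + 2)) * M.Ω k (Fin.last n) l)
      * M.c l = 1 / 6) :
    M.c (Fin.last n) = 1 ∧
    (∀ σ, ∑ j, M.table R σ (Sum.inr (Fin.last n)) j * M.abscissa R j = 1 / 2) ∧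
    (∀ σ, ∑ j, M.table R σ (Sum.inr (Fin.last n)) j * M.abscissa R j ^ 2 = 1 / 3) ∧
    ∀ σ ν, ∑ j, M.table R σ (Sum.inr (Fin.last n)) j *
      ∑ k, M.table R ν j k * M.abscissa R k = 1 / 6 := by
  have hcE : ∀ i, M.slowBase.cE i = M.c i := by
    intro i
    have h1 := M.sum_table_slow_explicit R (fun _ => (1 : ℝ)) i
    simp only [smul_eq_mul, mul_one] at h1
    have h2 := hrow 1 (Sum.inr i)
    rw [h1] at h2
    simpa [slowBase, Matrix.mulVec, dotProduct, abscissa] using h2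
  have hcI : ∀ i, M.slowBase.cI i = M.c i := by
    intro i
    have h1 := M.sum_table_slow_implicit R (fun _ => (1 : ℝ)) i
    simp only [smul_eq_mul, mul_one] at h1
    have h2 := hrow 2 (Sum.inr i)
    rw [h1] at h2
    simpa [slowBase, Matrix.mulVec, dotProduct, abscissa] using h2
  have qE : ∀ k : ℕ, k < 3 → ∑ l, M.Ωbar (Fin.last n) l * M.c l ^ k = 1 / (k + 1) := by
    intro k hk
    have := hslow.quadrature (k := k) hk 1 0
    simp only [hcE, hcI] at this
    simpa [slowBase] using this
  have qI : ∀ k : ℕ, k < 3 → ∑ l, (M.Ωbar + M.Γ) (Fin.last n) l * M.c l ^ k = 1 / (k + 1) := by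
    intro k hk
    have := hslow.quadrature (k := k) hk 0 1
    simp only [hcE, hcI] at this
    simpa [slowBase] using this
  -- In `coupling` the `β` coefficients select the outer weights and the `α` coefficients the inner
  -- table; setting them to `0` or `1` gives the four slow pairs.
  have tEE : ∑ l, M.Ωbar (Fin.last n) l * ∑ m, M.Ωbar l m * M.c m = 1 / 6 := by
    have := hslow.coupling (k := 1) (by norm_num) 1 1 0 0
    norm_num [hcE, hcI] at this
    simpa [slowBase] using this
  have tEI : ∑ l, M.Ωbar (Fin.last n) l * ∑ m, (M.Ωbar + M.Γ) l m * M.c m = 1 / 6 := by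
    have := hslow.coupling (k := 1) (by norm_num) 0 1 1 0
    norm_num [hcE, hcI] at this
    simpa [slowBase] using this
  have tIE : ∑ l, (M.Ωbar + M.Γ) (Fin.last n) l * ∑ m, M.Ωbar l m * M.c m = 1 / 6 := by
    have := hslow.coupling (k := 1) (by norm_num) 1 0 0 1
    norm_num [hcE, hcI] at this
    simpa [slowBase] using this
  have tII : ∑ l, (M.Ωbar + M.Γ) (Fin.last n) l * ∑ m, (M.Ωbar + M.Γ) l m * M.c m = 1 / 6 := by
    have := hslow.coupling (k := 1) (by norm_num) 0 0 1 1
    norm_num [hcE, hcI] at this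
    simpa [slowBase] using this
  -- The weights of the slow base method are its last row, so their sum is the last abscissa.
  have hlast : M.c (Fin.last n) = 1 := by
    have h := qE 0 (by norm_num)
    simp only [pow_zero, mul_one] at h
    rw [← hcE]
    simpa [slowBase, Matrix.mulVec, dotProduct] using h
  have b1 : ∑ i, R.b i * R.c i = 1 / 2 := by
    have := hb 1 (by simp)
    norm_num at this
    simpa using this
  have b2 : ∑ i, R.b i * R.c i ^ 2 = 1 / 3 := by
    have := hb 2 (by simp)
    norm_num at this
    simpa using this
  have b3 : ∑ i, R.b i * ∑ j, R.A i j * R.c j = 1 / 6 := by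
    have := hbA 1 (by simp)
    norm_num at this
    simpa using this
  -- Expanding `AFE` in powers of `R.c`, the factor of `Ω m` becomes `bᵀ A c ^ m = 1 / ((m + 1) (m +
  -- 2))`. The largest index `m = nΩ - 1` calls for fast order `nΩ + 1`.
  have tFE : ∑ k, R.b k * ∑ l, M.AFE R (Fin.last n, k) l * M.c l = 1 / 6 := by
    rw [← hcoupling]
    simp only [Finset.mul_sum, Finset.sum_mul]
    rw [Finset.sum_comm]
    refine Finset.sum_congr rfl fun l _ => ?_
    simp only [AFE, Matrix.of_apply, Finset.sum_mul, Finset.mul_sum]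
    rw [Finset.sum_comm]
    refine Finset.sum_congr rfl fun m _ => ?_
    rw [← hbA m (by omega), Finset.sum_mul, Finset.sum_mul]
    refine Finset.sum_congr rfl fun k _ => ?_
    simp only [Matrix.mulVec, dotProduct, Pi.pow_apply]
    ring
  have sF := fun x => M.sum_table_slow_fast R (V := ℝ) x (Fin.last n)
  have sE := fun x => M.sum_table_slow_explicit R (V := ℝ) x
  have sI := fun x => M.sum_table_slow_implicit R (V := ℝ) x
  have fF := fun x => M.sum_table_fast_fast R (V := ℝ) x
  have fE := fun x => M.sum_table_fast_explicit R (V := ℝ) x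
  have fI := fun x => M.sum_table_fast_implicit R (V := ℝ) x
  have sF' := fun x => M.sum_table_slow_fast R (V := ℝ) x
  simp only [smul_eq_mul] at sF sE sI fF fE fI sF'
  -- Within slow stage `l` the fast abscissae are `c l * R.c k` and the weights `c l * R.b k`, so `∑
  -- b c = 1/2` produces `c l ^ 2 / 2`.
  have hSF : ∀ l, ∑ k, M.table R 0 (Sum.inr l) k * M.abscissa R k = 1 / 2 * M.c l ^ 2 := by
    intro l
    rw [sF', ← b1, Finset.sum_mul, Finset.mul_sum]
    refine Finset.sum_congr rfl fun k _ => ?_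
    simp only [abscissa, Sum.elim_inl]
    ring
  have h13 : ∀ x : Fin (n + 1) → ℝ, ∑ l, x l * M.c l ^ 2 = 1 / 3 →
      ∑ l, x l * (1 / 2 * M.c l ^ 2) = 1 / 6 := by
    intro x hx
    rw [show (1 / 6 : ℝ) = 1 / 2 * (1 / 3) by norm_num, ← hx, Finset.mul_sum]
    exact Finset.sum_congr rfl fun l _ => by ring
  have qE1 : ∑ l, M.Ωbar (Fin.last n) l * M.c l = 1 / 2 := by
    have := qE 1 (by norm_num)
    norm_num at this
    simpa using this
  have qI1 : ∑ l, (M.Ωbar + M.Γ) (Fin.last n) l * M.c l = 1 / 2 := by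
    have := qI 1 (by norm_num)
    norm_num at this
    simpa using this
  have qE2 : ∑ l, M.Ωbar (Fin.last n) l * M.c l ^ 2 = 1 / 3 := by
    have := qE 2 (by norm_num)
    norm_num at this
    simpa using this
  have qI2 : ∑ l, (M.Ωbar + M.Γ) (Fin.last n) l * M.c l ^ 2 = 1 / 3 := by
    have := qI 2 (by norm_num)
    norm_num at this
    simpa using this
  refine ⟨hlast, ?_, ?_, ?_⟩
  · rw [Fin.forall_fin_succ, Fin.forall_fin_two]
    refine ⟨?_, ?_, ?_⟩
    · rw [sF]; simpa [abscissa, hlast] using b1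
    · exact (sE _ _).trans qE1
    · exact (sI _ _).trans qI1
  · rw [Fin.forall_fin_succ, Fin.forall_fin_two]
    refine ⟨?_, ?_, ?_⟩
    · rw [sF _]; simpa [abscissa, hlast] using b2
    · exact (sE _ _).trans qE2
    · exact (sI _ _).trans qI2
  · rw [Fin.forall_fin_succ, Fin.forall_fin_two]
    simp only [Fin.forall_fin_succ (n := 2), Fin.forall_fin_two]
    -- The nine pairs are grouped by outer table in the order fast, explicit, implicit. The two
    -- fast-slow pairs share `tFE`, since `AFI` is `AFE`.
    refine ⟨⟨?_, ?_, ?_⟩, ⟨?_, ?_, ?_⟩, ?_, ?_, ?_⟩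
    · rw [sF, hlast]; simpa [fF, abscissa, hlast, -Fintype.sum_sum_type] using b3
    · rw [sF, hlast, one_mul]
      exact (Finset.sum_congr rfl fun k _ => congrArg _ (fE _ _)).trans tFE
    · rw [sF, hlast, one_mul]
      exact (Finset.sum_congr rfl fun k _ => congrArg _ (fI _ _)).trans tFE
    · exact (sE _ _).trans ((Finset.sum_congr rfl fun l _ => congrArg _ (hSF l)).trans (h13 _ qE2))
    · exact (sE _ _).trans ((Finset.sum_congr rfl fun l _ => congrArg _ (sE _ l)).trans tEE)
    · exact (sE _ _).trans ((Finset.sum_congr rfl fun l _ => congrArg _ (sI _ l)).trans tEI)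
    · exact (sI _ _).trans ((Finset.sum_congr rfl fun l _ => congrArg _ (hSF l)).trans (h13 _ qI2))
    · exact (sI _ _).trans ((Finset.sum_congr rfl fun l _ => congrArg _ (sE _ l)).trans tIE)
    · exact (sI _ _).trans ((Finset.sum_congr rfl fun l _ => congrArg _ (sI _ l)).trans tII)

end IMEXMRISR

/-! ### Third-order accuracy of the scheme -/

theorem theorem2 {n nΩ sF : ℕ} (M : IMEXMRISR n nΩ) (R : RKMethod sF)
    (hcons : M.InternallyConsistent R)
    (hslow : M.slowBase.HasOrder 3)
    (hfast : R.HasOrder (max 3 (nΩ + 1)))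
    (hcoupling : dotProduct (Pi.single (Fin.last n) (1 : ℝ))
      ((∑ k : Fin nΩ, (1 / (((k : ℝ) + 1) * ((k : ℝ) + 2))) • M.Ω k).mulVec M.c) = 1 / 6) :
    M.HasOrder R 3 := by
  have hb : ∀ k < max 3 (nΩ + 1), ∑ i, R.b i * R.c i ^ k = 1 / (k + 1) :=
    fun k hk => hfast.quadrature hk
  have hbΩ : ∀ k < nΩ, ∑ i, R.b i * R.c i ^ k = 1 / (k + 1) := fun k hk => hb k (by omega)
  have hrow := hcons.sum_table (by simpa using hb 0 (by simp))
  obtain ⟨hlast, h2, h3, h4⟩ := IMEXMRISR.order_conditions hrow hslow hb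
    (fun k hk => hfast.coupling hk) (by
      simpa [Matrix.mulVec, dotProduct, Pi.single_apply, Matrix.sum_apply] using hcoupling)
  intro d fF fE fI hF hE hI t₀ T y₀ y hT hy
  -- The exact solution paired with time solves the autonomous system, with the step parameter
  -- starting at `0`.
  have hu : ∀ h ∈ Set.Icc 0 T, HasDerivWithinAt (fun h => (t₀ + h, y (t₀ + h)))
      (∑ σ, IMEXMRISR.autonomousRHS fF fE fI σ (t₀ + h, y (t₀ + h))) (Set.Icc 0 T) h := by
    intro h hh
    have h1 : HasDerivWithinAt (fun h => t₀ + h) 1 (Set.Icc 0 T) h :=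
      ((hasDerivAt_id h).const_add t₀).hasDerivWithinAt
    have h2 := (hy.2 (t₀ + h) ⟨by linarith [hh.1], by linarith [hh.2]⟩).scomp h h1
      fun x hx => ⟨by linarith [hx.1], by linarith [hx.2]⟩
    refine (h1.prodMk h2).congr_deriv ?_
    simp [Fin.sum_univ_three, IMEXMRISR.autonomousRHS]
    abel
  obtain ⟨r, hr, H₀, hH₀, C, hC⟩ := PartitionedStageEq.local_error (u₀ := (t₀, y₀))
    (IMEXMRISR.contDiff_autonomousRHS hF hE hI) hrow (e := Sum.inr (Fin.last n)) hlast h2 h3 h4 hT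
    (by simp [hy.1]) hu
  have hS : 0 < ∑ i, |M.abscissa R i| + 1 := by positivity
  -- The second bound on `H` keeps the stage times within `r` of `t₀`, so that stages near `y₀` lift
  -- to the ball around `(t₀, y₀)` in the extended space.
  refine ⟨r, hr, min H₀ (r / (∑ i, |M.abscissa R i| + 1)), lt_min hH₀ (div_pos hr hS), C,
    fun H hH hH' => ?_⟩
  rw [lt_min_iff, lt_div_iff₀ hS] at hH'
  obtain ⟨⟨U, hUr, hU⟩, hall⟩ := hC H hH hH'.1
  refine ⟨⟨fun i => (U i).2, fun i => (norm_snd_le (U i - (t₀, y₀))).trans (hUr i), ?_⟩,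
    fun Z hZr hZ => ?_⟩
  · rw [← IMEXMRISR.partitionedStageEq_iff (hrow 0) hbΩ]
    convert hU using 2 with i
    exact Prod.ext (IMEXMRISR.partitionedStageEq_fst (hrow 0) hU i).symm rfl
  · refine (norm_snd_le _).trans (hall (fun i => (t₀ + M.abscissa R i * H, Z i)) (fun i => ?_)
      ((IMEXMRISR.partitionedStageEq_iff (hrow 0) hbΩ Z).2 hZ))
    refine norm_prod_le_iff.2 ⟨?_, hZr i⟩
    have := Finset.single_le_sum (f := fun i => |M.abscissa R i|) (fun _ _ => abs_nonneg _)
      (Finset.mem_univ i)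
    simp only [Prod.mk_sub_mk, add_sub_cancel_left, Real.norm_eq_abs, abs_mul, abs_of_pos hH]
    nlinarith
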